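/- Let $F$ be a field of characteristic zero, let $f\in F[x,y,z]$, and put $R=F[x,y,z]/(f)$. Write $\Omega^p_R=\bigwedge^p_R\Omega^1_{R/F}$ for the modules of Kähler differentials of $R$ relative to $F$, and $\operatorname{tors}(M)$ for the torsion submodule of an $R$-module $M$, i.e. the set of elements annihilated by some non-zero-divisor of $R$. Suppose that $X=\operatorname{Spec} R$ is a two-dimensional isolated hypersurface singularity, meaning that the support of $\Omega^3_R$ (the singular locus of $X$) consists of exactly one point, the origin, defined by the maximal ideal $(x,y,z)$ of $R$. Let $$\tau=\operatorname{length}_R\Bigl(R/\bigl(\tfrac{\partial f}{\partial x},\tfrac{\partial f}{\partial y},\tfrac{\partial f}{\partial z}\bigr)\Bigr)$$ be the Tjurina number. Then $\tau$ is finite, there are isomorphisms of $R$-modules $$\Omega^3_R\cong\operatorname{Ext}^1_R(\Omega^1_R,R)\cong\operatorname{Ext}^2_R(\Omega^2_R,R),\qquad \operatorname{tors}(\Omega^2_R)\cong\operatorname{Ext}^1_R(\Omega^2_R,R),$$ and each of these five $R$-modules has length $\tau$. -/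

import Mathlib

namespace SurfaceSing

open MvPolynomial CategoryTheory

universe u

variable {F : Type u} [Field F]

/-- The hypersurface ring `R = F[x,y,z]/(f)`, with `x, y, z` the variables `X 0, X 1, X 2`. -/
abbrev HypersurfaceRing (f : MvPolynomial (Fin 3) F) : Type u :=
  MvPolynomial (Fin 3) F ⧸ Ideal.span {f}

/-- The module `Ω^p_{R/F} = ⋀^p_R Ω^1_{R/F}` of Kähler `p`-forms of `R = F[x,y,z]/(f)`
relative to `F`. -/
abbrev KahlerForms (f : MvPolynomial (Fin 3) F) (p : ℕ) : Type u :=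
  ⋀[HypersurfaceRing f]^p (Ω[HypersurfaceRing f⁄F])

/-- The ideal `(∂f/∂x, ∂f/∂y, ∂f/∂z)` of `R = F[x,y,z]/(f)`. -/
noncomputable def jacobianIdeal (f : MvPolynomial (Fin 3) F) : Ideal (HypersurfaceRing f) :=
  Ideal.span (Set.range fun i : Fin 3 => Ideal.Quotient.mk (Ideal.span {f}) (pderiv i f))

/-- The ideal `(x, y, z)` of `R = F[x,y,z]/(f)`. -/
noncomputable def originIdeal (f : MvPolynomial (Fin 3) F) : Ideal (HypersurfaceRing f) :=
  Ideal.span (Set.range fun i : Fin 3 => Ideal.Quotient.mk (Ideal.span {f}) (X i))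

/-- The Tjurina number: the length of the `R`-module `R/(∂f/∂x, ∂f/∂y, ∂f/∂z)`
(a priori in `ℕ∞`). -/
noncomputable def tjurinaNumber (f : MvPolynomial (Fin 3) F) : ℕ∞ :=
  Module.length (HypersurfaceRing f) (HypersurfaceRing f ⧸ jacobianIdeal f)

/-- `X = Spec F[x,y,z]/(f)` is a two-dimensional isolated hypersurface singularity: the support
of `Ω^3_{R/F}` (whose points are the singular points of `X`) consists of exactly one point, the
origin, given by the prime ideal `(x, y, z)` of `R`. This forces `f ≠ 0` and `f ∈ (x, y, z)`,
so that `X` is indeed a surface through the origin. -/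
def IsIsolatedHypersurfaceSingularity (f : MvPolynomial (Fin 3) F) : Prop :=
  ∃ x₀ : PrimeSpectrum (HypersurfaceRing f), x₀.asIdeal = originIdeal f ∧
    Module.support (HypersurfaceRing f) (KahlerForms f 3) = {x₀}

/-- `Ext^i_R(M, R)` for `R = F[x,y,z]/(f)`, with its `R`-module structure. -/
abbrev ExtToRing (f : MvPolynomial (Fin 3) F) (M : Type u) [AddCommGroup M]
    [Module (HypersurfaceRing f) M] (i : ℕ) : Type u :=
  Abelian.Ext (ModuleCat.of (HypersurfaceRing f) M)
    (ModuleCat.of (HypersurfaceRing f) (HypersurfaceRing f)) i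

end SurfaceSing

/-! Write `a` for the gradient of `f` in `R³`. The conormal sequence gives `Ω¹ = R³/(a)`, hence `Ω²
= R³/(a ⨯₃ R³)` and `Ω³ = R/J`, where `J` is generated by the entries of `a`. Everything is read off
the Koszul complex `R → R³ → R³ → R` of `a`.

Since `J` lies in no prime other than the origin, and the origin is associated neither to `R` nor to
`R/(b₀)` for a non-zero-divisor `b₀`, prime avoidance over the infinite field `F` yields an
invertible matrix `P` such that the first two entries of `b = P *ᵥ a` form a regular pair. The
Koszul complex is then exact in its first two places, so `0 → R → R³ → Ω¹ → 0` and `0 → Ω¹ → R³ → Ω²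
→ 0` are exact. Dualizing gives `Ext¹(Ω¹, R) = R/J`, `Ext²(Ω², R) = Ext¹(Ω¹, R)` and `Ext¹(Ω², R) =
H²`; the torsion of `Ω²` is also `H²`, cycles modulo boundaries.

For the lengths, `B = R/(b₀, b₁)` is Artinian because `dim R ≤ 2`. Multiplication by `b₂` on `B` has
kernel `H²` and cokernel `R/J`, which therefore have the same finite length. -/

namespace SurfaceSing

open Matrix

/-! ### The Koszul complex of three elements and the length of its `H²` -/

section Koszul

variable {R : Type*} [CommRing R]

/-- The linear form `v ↦ a ⬝ᵥ v` on `R³`. -/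
def dotForm (a : Fin 3 → R) : (Fin 3 → R) →ₗ[R] R := dotProductBilin R R a

@[simp]
theorem dotForm_apply (a v : Fin 3 → R) : dotForm a v = a ⬝ᵥ v := rfl

/-- The vectors of `R³` orthogonal to `a`: the 2-cocycles of the Koszul complex
`R → R³ → R³ → R` with differentials `r ↦ r • a`, `v ↦ a ⨯₃ v`, `v ↦ a ⬝ᵥ v`. -/
def koszulCycles (a : Fin 3 → R) : Submodule R (Fin 3 → R) := LinearMap.ker (dotForm a)

/-- The 2-coboundaries `a ⨯₃ w` of the Koszul complex of `a`. -/
def koszulBoundaries (a : Fin 3 → R) : Submodule R (Fin 3 → R) :=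
  LinearMap.range (crossProduct a)

/-- The second cohomology of the Koszul complex of `a`. -/
abbrev KoszulH2 (a : Fin 3 → R) : Type _ :=
  koszulCycles a ⧸ (koszulBoundaries a).submoduleOf (koszulCycles a)

theorem mem_koszulCycles {a v : Fin 3 → R} : v ∈ koszulCycles a ↔ a ⬝ᵥ v = 0 := Iff.rfl

theorem mem_koszulBoundaries {a v : Fin 3 → R} :
    v ∈ koszulBoundaries a ↔ ∃ w, a ⨯₃ w = v := Iff.rfl

theorem koszulBoundaries_le_koszulCycles (a : Fin 3 → R) :
    koszulBoundaries a ≤ koszulCycles a := by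
  rintro _ ⟨w, rfl⟩
  exact dot_self_cross a w

theorem span_range_le_span_range_mulVec (P : Matrix (Fin 3) (Fin 3) R) (a : Fin 3 → R) :
    Ideal.span (Set.range (P *ᵥ a)) ≤ Ideal.span (Set.range a) := by
  rw [Ideal.span_le]
  rintro _ ⟨i, rfl⟩
  simp only [mulVec, dotProduct, SetLike.mem_coe]
  exact Ideal.sum_mem _ fun j _ => Ideal.mul_mem_left _ _ (Ideal.subset_span ⟨j, rfl⟩)

theorem span_range_mulVec {P : Matrix (Fin 3) (Fin 3) R} (hP : IsUnit P.det) (a : Fin 3 → R) :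
    Ideal.span (Set.range (P *ᵥ a)) = Ideal.span (Set.range a) := by
  refine le_antisymm (span_range_le_span_range_mulVec P a) ?_
  have h := span_range_le_span_range_mulVec P⁻¹ (P *ᵥ a)
  rwa [mulVec_mulVec, nonsing_inv_mul _ hP, one_mulVec] at h

/-- The transposed adjugate is the cofactor matrix, that is `⋀²P` under `⋀²R³ = R³`; `P` need not be
invertible. -/
theorem mulVec_cross_mulVec (P : Matrix (Fin 3) (Fin 3) R) (a v : Fin 3 → R) :
    (P *ᵥ a) ⨯₃ (P *ᵥ v) = P.adjugateᵀ *ᵥ (a ⨯₃ v) := by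
  rw [adjugate_fin_three]
  ext i
  fin_cases i <;>
    simp [cross_apply, mulVec, dotProduct, Fin.sum_univ_three, transpose] <;> ring

theorem transpose_mulVec_mulVec_cross (P : Matrix (Fin 3) (Fin 3) R) (a v : Fin 3 → R) :
    Pᵀ *ᵥ ((P *ᵥ a) ⨯₃ (P *ᵥ v)) = P.det • (a ⨯₃ v) := by
  rw [mulVec_cross_mulVec, mulVec_mulVec, ← transpose_mul, adjugate_mul, transpose_smul,
    transpose_one, smul_mulVec, one_mulVec]

/-- The entries `b 0, b 1` form a weakly regular sequence. -/
structure IsRegularPair (b : Fin 3 → R) : Prop where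
  fst : ∀ r, b 0 * r = 0 → r = 0
  snd : ∀ r s, b 1 * r = b 0 * s → ∃ t, r = b 0 * t

namespace IsRegularPair

variable {b : Fin 3 → R} (hb : IsRegularPair b)
include hb

theorem mul_left_cancel {r s : R} (h : b 0 * r = b 0 * s) : r = s :=
  sub_eq_zero.mp (hb.fst _ (by rw [mul_sub, h, sub_self]))

theorem exists_smul_of_cross_eq_zero {v : Fin 3 → R} (h : b ⨯₃ v = 0) : ∃ r : R, r • b = v := by
  rw [cross_apply] at h
  have h1 := congr_fun h 1
  have h2 := congr_fun h 2
  simp only [Fin.isValue, cons_val_one, cons_val_zero, Pi.zero_apply, cons_val] at h1 h2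
  obtain ⟨t, ht⟩ := hb.snd (v 0) (v 1) (by linear_combination -h2)
  have e1 : v 1 = b 1 * t := hb.mul_left_cancel (by rw [ht] at h2; linear_combination h2)
  have e2 : v 2 = b 2 * t := hb.mul_left_cancel (by rw [ht] at h1; linear_combination -h1)
  refine ⟨t, ?_⟩
  ext i
  fin_cases i
  · simp [ht, mul_comm]
  · simp [e1, mul_comm]
  · simp [e2, mul_comm]

/-- Subtracting a boundary makes the last coordinate vanish; what remains is a relation between `b
0` and `b 1`, which regularity makes trivial. -/
theorem mem_koszulBoundaries {v : Fin 3 → R} (hv : b ⬝ᵥ v = 0)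
    (h : v 2 ∈ Ideal.span {b 0, b 1}) : v ∈ koszulBoundaries b := by
  obtain ⟨s, t, hst⟩ := Ideal.mem_span_pair.mp h
  simp only [dotProduct, Fin.sum_univ_three] at hv
  obtain ⟨r, hr⟩ := hb.snd (v 1 + t * b 2) (-(v 0 + s * b 2))
    (by linear_combination hv + b 2 * hst)
  have e0 : v 0 + s * b 2 = - (b 1 * r) :=
    hb.mul_left_cancel (by linear_combination hv + b 2 * hst - b 1 * hr)
  refine ⟨![-t, s, -r], ?_⟩
  rw [cross_apply]
  ext i
  fin_cases i
  · simp; linear_combination -e0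
  · simp; linear_combination -hr
  · simp; linear_combination hst

end IsRegularPair

section ChangeOfCoordinates

variable {P : Matrix (Fin 3) (Fin 3) R} {a : Fin 3 → R} (hP : IsUnit P.det)
  (hb : IsRegularPair (P *ᵥ a))
include hP hb

omit hP in
theorem eq_zero_of_smul_eq_zero {r : R} (h : r • a = 0) : r = 0 := by
  refine hb.fst r ?_
  have := congr_fun (congr_arg (P *ᵥ ·) h) 0
  simpa [mulVec_smul, mul_comm] using this

theorem exists_smul_of_cross_eq_zero {v : Fin 3 → R} (h : a ⨯₃ v = 0) : ∃ r : R, r • a = v := by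
  obtain ⟨r, hr⟩ := hb.exists_smul_of_cross_eq_zero (v := P *ᵥ v)
    (by rw [mulVec_cross_mulVec, h, mulVec_zero])
  refine ⟨r, ?_⟩
  have := congr_arg (P⁻¹ *ᵥ ·) hr
  simpa [mulVec_smul, mulVec_mulVec, nonsing_inv_mul _ hP] using this

/-- The last coordinate, in the basis dual to the one given by `P`, of a Koszul cycle, taken
modulo the first two entries of `P *ᵥ a`. -/
noncomputable def cyclesToQuotient (P : Matrix (Fin 3) (Fin 3) R) (a : Fin 3 → R) :
    koszulCycles a →ₗ[R] R ⧸ Ideal.span {(P *ᵥ a) 0, (P *ᵥ a) 1} :=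
  (Submodule.mkQ _ ∘ₗ LinearMap.proj 2 ∘ₗ (Pᵀ⁻¹).mulVecLin) ∘ₗ (koszulCycles a).subtype

omit hP hb in
theorem cyclesToQuotient_apply (v : koszulCycles a) :
    cyclesToQuotient P a v = Submodule.Quotient.mk ((Pᵀ⁻¹ *ᵥ (v : Fin 3 → R)) 2) := rfl

omit hb in
-- Cycles are covectors, so they transform by the inverse transpose.
theorem mulVec_dot_transpose_inv_mulVec (v : Fin 3 → R) :
    (P *ᵥ a) ⬝ᵥ (Pᵀ⁻¹ *ᵥ v) = a ⬝ᵥ v := by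
  have hPt : IsUnit Pᵀ.det := by rwa [det_transpose]
  rw [← vecMul_transpose, ← dotProduct_mulVec, mulVec_mulVec, mul_nonsing_inv _ hPt, one_mulVec]

theorem ker_cyclesToQuotient :
    LinearMap.ker (cyclesToQuotient P a) = (koszulBoundaries a).submoduleOf (koszulCycles a) := by
  have hPt : IsUnit Pᵀ.det := by rwa [det_transpose]
  ext ⟨v, hv⟩
  rw [LinearMap.mem_ker, cyclesToQuotient_apply, Submodule.Quotient.mk_eq_zero,
    Submodule.submoduleOf, Submodule.mem_comap]
  constructor
  · intro h
    obtain ⟨w, hw⟩ := hb.mem_koszulBoundaries (v := Pᵀ⁻¹ *ᵥ v)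
      (by rw [mulVec_dot_transpose_inv_mulVec hP]; exact hv) h
    -- The factor `P.det` absorbs the determinant in `transpose_mulVec_mulVec_cross`.
    refine ⟨P.det • (P⁻¹ *ᵥ w), ?_⟩
    have := transpose_mulVec_mulVec_cross P a (P⁻¹ *ᵥ w)
    rw [mulVec_mulVec, mul_nonsing_inv _ hP, one_mulVec, hw, mulVec_mulVec,
      mul_nonsing_inv _ hPt, one_mulVec] at this
    simp [this]
  · rintro ⟨w, rfl⟩
    have h := mulVec_cross_mulVec P a w
    have h2 : P.det • (Pᵀ⁻¹ *ᵥ (a ⨯₃ w)) = (P *ᵥ a) ⨯₃ (P *ᵥ w) := by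
      rw [← mulVec_smul, ← transpose_mulVec_mulVec_cross, mulVec_mulVec,
        nonsing_inv_mul _ hPt, one_mulVec]
    have h3 := congr_fun h2 2
    rw [cross_apply (P *ᵥ a)] at h3
    simp only [Pi.smul_apply, smul_eq_mul, cons_val] at h3
    rw [← Ideal.unit_mul_mem_iff_mem _ hP, h3]
    refine Ideal.sub_mem _ (Ideal.mul_mem_right _ _ (Ideal.subset_span (by simp)))
      (Ideal.mul_mem_right _ _ (Ideal.subset_span (by simp)))

omit hb in
-- In the new coordinates, `c` is the last coordinate of a cycle exactly when `b₂ c ∈ (b₀, b₁)`: the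
-- coefficients of such a relation, negated, supply the other two coordinates.
theorem range_cyclesToQuotient :
    LinearMap.range (cyclesToQuotient P a) =
      LinearMap.ker (LinearMap.lsmul R (R ⧸ Ideal.span {(P *ᵥ a) 0, (P *ᵥ a) 1}) ((P *ᵥ a) 2)) := by
  have hPt : IsUnit Pᵀ.det := by rwa [det_transpose]
  ext x
  constructor
  · rintro ⟨⟨v, hv⟩, rfl⟩
    rw [mem_koszulCycles, ← mulVec_dot_transpose_inv_mulVec hP] at hv
    rw [LinearMap.mem_ker, LinearMap.lsmul_apply, cyclesToQuotient_apply,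
      ← Submodule.Quotient.mk_smul, Submodule.Quotient.mk_eq_zero]
    simp only [dotProduct, Fin.sum_univ_three] at hv
    refine Ideal.mem_span_pair.mpr ⟨-(Pᵀ⁻¹ *ᵥ v) 0, -(Pᵀ⁻¹ *ᵥ v) 1, ?_⟩
    rw [smul_eq_mul]
    linear_combination -hv
  · intro hx
    obtain ⟨c, rfl⟩ := Submodule.Quotient.mk_surjective _ x
    rw [LinearMap.mem_ker, LinearMap.lsmul_apply, 
      ← Submodule.Quotient.mk_smul, Submodule.Quotient.mk_eq_zero] at hx
    obtain ⟨s, t, hst⟩ := Ideal.mem_span_pair.mp hx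
    have e : Pᵀ⁻¹ *ᵥ (Pᵀ *ᵥ ![-s, -t, c]) = ![-s, -t, c] := by
      rw [mulVec_mulVec, nonsing_inv_mul _ hPt, one_mulVec]
    refine ⟨⟨Pᵀ *ᵥ ![-s, -t, c], ?_⟩, ?_⟩
    · rw [mem_koszulCycles, ← mulVec_dot_transpose_inv_mulVec hP, e, dotProduct, Fin.sum_univ_three]
      rw [smul_eq_mul] at hst
      simp only [cons_val]
      linear_combination -hst
    · rw [cyclesToQuotient_apply]
      simp only [e]
      rfl

end ChangeOfCoordinates

/-- For an endomorphism of a module of finite length, the kernel and the cokernel have the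
same length. -/
theorem length_ker_eq_length_of_exact {B C : Type*} [AddCommGroup B] [Module R B]
    [AddCommGroup C] [Module R C] [IsArtinian R B] [IsNoetherian R B]
    (g : B →ₗ[R] B) (q : B →ₗ[R] C) (hq : Function.Surjective q)
    (hgq : LinearMap.range g = LinearMap.ker q) :
    Module.length R (LinearMap.ker g) = Module.length R C := by
  have h1 := Module.length_eq_add_of_exact (LinearMap.ker g).subtype g.rangeRestrict
    (Submodule.subtype_injective _) g.surjective_rangeRestrict
    (by rw [LinearMap.exact_iff, LinearMap.ker_rangeRestrict, Submodule.range_subtype])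
  have h2 := Module.length_eq_add_of_exact (LinearMap.range g).subtype q
    (Submodule.subtype_injective _) hq
    (by rw [LinearMap.exact_iff, hgq, Submodule.range_subtype])
  have hB : Module.length R (LinearMap.range g) ≠ ⊤ := Module.length_ne_top
  rw [h1, add_comm] at h2
  exact WithTop.add_left_cancel hB h2

theorem span_pair_mulVec_le (P : Matrix (Fin 3) (Fin 3) R) (a : Fin 3 → R) :
    Ideal.span {(P *ᵥ a) 0, (P *ᵥ a) 1} ≤ Ideal.span (Set.range a) := by
  refine le_trans (Ideal.span_mono ?_) (span_range_le_span_range_mulVec P a)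
  rintro _ (rfl | rfl)
  exacts [⟨0, rfl⟩, ⟨1, rfl⟩]

theorem isArtinian_quotient_span_pair {b : Fin 3 → R}
    [IsArtinianRing (R ⧸ Ideal.span {b 0, b 1})] :
    IsArtinian R (R ⧸ Ideal.span {b 0, b 1}) :=
  isArtinian_of_surjective_algebraMap
    (R := R ⧸ Ideal.span {b 0, b 1}) Ideal.Quotient.mk_surjective

theorem length_quotient_ne_top (P : Matrix (Fin 3) (Fin 3) R) (a : Fin 3 → R) [IsNoetherianRing R]
    [IsArtinianRing (R ⧸ Ideal.span {(P *ᵥ a) 0, (P *ᵥ a) 1})] :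
    Module.length R (R ⧸ Ideal.span (Set.range a)) ≠ ⊤ := by
  have hart := isArtinian_quotient_span_pair (b := P *ᵥ a)
  have hle := span_pair_mulVec_le P a
  exact ne_top_of_le_ne_top Module.length_ne_top
    (Module.length_le_of_surjective (Submodule.factor hle) (Submodule.factor_surjective hle))

/-- Multiplication by the third entry of `P *ᵥ a`, on the Artinian quotient by the first two, has
kernel `H²` and cokernel `R/(a)`. -/
theorem length_koszulH2 {P : Matrix (Fin 3) (Fin 3) R} {a : Fin 3 → R} (hP : IsUnit P.det)
    (hb : IsRegularPair (P *ᵥ a)) [IsNoetherianRing R]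
    [IsArtinianRing (R ⧸ Ideal.span {(P *ᵥ a) 0, (P *ᵥ a) 1})] :
    Module.length R (KoszulH2 a) = Module.length R (R ⧸ Ideal.span (Set.range a)) := by
  have hle := span_pair_mulVec_le P a
  have hart := isArtinian_quotient_span_pair (b := P *ᵥ a)
  have e : KoszulH2 a ≃ₗ[R] LinearMap.ker (LinearMap.lsmul R
      (R ⧸ Ideal.span {(P *ᵥ a) 0, (P *ᵥ a) 1}) ((P *ᵥ a) 2)) :=
    (Submodule.quotEquivOfEq _ _ (ker_cyclesToQuotient hP hb).symm).trans
      ((cyclesToQuotient P a).quotKerEquivRange.trans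
        (LinearEquiv.ofEq _ _ (range_cyclesToQuotient hP)))
  rw [e.length_eq]
  refine length_ker_eq_length_of_exact _ (Submodule.factor hle) (Submodule.factor_surjective hle) ?_
  ext x
  obtain ⟨c, rfl⟩ := Submodule.Quotient.mk_surjective _ x
  change _ ↔ (Submodule.Quotient.mk c : R ⧸ Ideal.span (Set.range a)) = 0
  rw [Submodule.Quotient.mk_eq_zero, ← span_range_mulVec hP, LinearMap.mem_range]
  constructor
  · rintro ⟨y, hy⟩
    obtain ⟨d, rfl⟩ := Submodule.Quotient.mk_surjective _ y
    rw [LinearMap.lsmul_apply, ← Submodule.Quotient.mk_smul, Submodule.Quotient.eq] at hy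
    rw [← span_range_mulVec hP] at hle
    have h2 : (P *ᵥ a) 2 ∈ Ideal.span (Set.range (P *ᵥ a)) := Ideal.subset_span ⟨2, rfl⟩
    have := sub_mem (Ideal.mul_mem_right d _ h2) (hle hy)
    simpa using this
  · intro hc
    obtain ⟨d, hd⟩ := (Submodule.mem_span_range_iff_exists_fun R).mp hc
    rw [Fin.sum_univ_three] at hd
    refine ⟨Submodule.Quotient.mk (d 2), ?_⟩
    rw [LinearMap.lsmul_apply, ← Submodule.Quotient.mk_smul, Submodule.Quotient.eq]
    refine Ideal.mem_span_pair.mpr ⟨-d 0, -d 1, ?_⟩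
    rw [← hd]
    simp only [smul_eq_mul]
    ring

end Koszul

end SurfaceSing

/-! ### Exterior powers of `R³/(a)` -/

namespace SurfaceSing

open Matrix

section ExteriorPowers

variable {R : Type*} [CommRing R]

section Descent

variable {ι N M Q : Type*} [AddCommGroup N] [Module R N] [AddCommGroup M] [Module R M]
  [AddCommGroup Q] [Module R Q]

/-- Replace the arguments one at a time: each replacement changes the value by a term with one
argument in `ker p`. -/
theorem alternatingMap_eq_of_comp_eq [Finite ι] (f : N [⋀^ι]→ₗ[R] Q) (p : N →ₗ[R] M)
    (hf : ∀ v i, p (v i) = 0 → f v = 0) {v w : ι → N} (h : ∀ i, p (v i) = p (w i)) :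
    f v = f w := by
  classical
  have := Fintype.ofFinite ι
  have key : ∀ s : Finset ι, f (s.piecewise v w) = f w := by
    intro s
    induction s using Finset.induction_on with
    | empty => simp
    | insert i s _ ih =>
      rw [Finset.piecewise_insert, ← ih, ← sub_eq_zero]
      nth_rw 2 [← Function.update_eq_self i (s.piecewise v w)]
      rw [← f.map_update_sub]
      refine hf _ i ?_
      by_cases hi : i ∈ s <;> simp [hi, h]
  simpa using key Finset.univ

/-- An alternating map that vanishes as soon as one argument lies in the kernel of a surjection
descends along this surjection. -/
theorem exists_alternatingMap_comp_eq [Finite ι] (f : N [⋀^ι]→ₗ[R] Q) (p : N →ₗ[R] M)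
    (hp : Function.Surjective p) (hf : ∀ v i, p (v i) = 0 → f v = 0) :
    ∃ g : M [⋀^ι]→ₗ[R] Q, g.compLinearMap p = f := by
  -- `σ` is only a set-theoretic section; `key` makes its failure of linearity invisible to `f`.
  choose σ hσ using hp
  have key := fun {v w} => alternatingMap_eq_of_comp_eq f p hf (v := v) (w := w)
  refine ⟨{ toFun := fun m => f (σ ∘ m)
            map_update_add' := fun m i x y => ?_
            map_update_smul' := fun m i r x => ?_
            map_eq_zero_of_eq' := fun m i j h hij =>
              f.map_eq_zero_of_eq _ (congr_arg σ h) hij }, ?_⟩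
  · rw [Function.comp_update, Function.comp_update, Function.comp_update, ← f.map_update_add]
    refine key fun j => ?_
    by_cases hj : j = i
    · subst hj; simp [hσ]
    · simp [hj]
  · rw [Function.comp_update, Function.comp_update, ← f.map_update_smul]
    refine key fun j => ?_
    by_cases hj : j = i
    · subst hj; simp [hσ]
    · simp [hj]
  · ext v
    exact key fun j => by simp [hσ]

end Descent

/-- The cross product as an alternating map. -/
def crossAlternating : (Fin 3 → R) [⋀^Fin 2]→ₗ[R] (Fin 3 → R) where
  toFun v := v 0 ⨯₃ v 1
  map_update_add' v i x y := by
    fin_cases i <;> simp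
  map_update_smul' v i r x := by
    fin_cases i <;> simp
  map_eq_zero_of_eq' v i j h hij := by
    fin_cases i <;> fin_cases j <;> simp_all

@[simp]
theorem crossAlternating_apply (v : Fin 2 → Fin 3 → R) : crossAlternating v = v 0 ⨯₃ v 1 := rfl

variable {M : Type*} [AddCommGroup M] [Module R M] {p : (Fin 3 → R) →ₗ[R] M}

/-- The map `R³ → ⋀²M` identifying `R³` with `⋀²R³`, followed by `⋀² p`. -/
noncomputable def toExteriorTwo (p : (Fin 3 → R) →ₗ[R] M) : (Fin 3 → R) →ₗ[R] ⋀[R]^2 M :=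
  Fintype.linearCombination R
    ![exteriorPower.ιMulti R 2 ![p (Pi.single 1 1), p (Pi.single 2 1)],
      exteriorPower.ιMulti R 2 ![p (Pi.single 2 1), p (Pi.single 0 1)],
      exteriorPower.ιMulti R 2 ![p (Pi.single 0 1), p (Pi.single 1 1)]]

theorem toExteriorTwo_cross (p : (Fin 3 → R) →ₗ[R] M) (v : Fin 2 → Fin 3 → R) :
    toExteriorTwo p (v 0 ⨯₃ v 1) = exteriorPower.ιMulti R 2 (p ∘ v) := by
  have h : (toExteriorTwo p).compAlternatingMap crossAlternating =
      (exteriorPower.ιMulti R 2).compLinearMap p := by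
    refine Module.Basis.ext_alternating (Pi.basisFun R (Fin 3)) fun v hv => ?_
    simp only [LinearMap.compAlternatingMap_apply, crossAlternating_apply, Pi.basisFun_apply,
      AlternatingMap.compLinearMap_apply]
    have swap : ∀ x y : M, exteriorPower.ιMulti R 2 ![x, y] = - exteriorPower.ιMulti R 2 ![y, x] := by
      intro x y
      have := (exteriorPower.ιMulti R 2 (M := M)).map_swap ![y, x] (i := 0) (j := 1) (by decide)
      rw [← this]
      congr 1
      ext i; fin_cases i <;> rfl
    have e : (fun i => p (Pi.single (v i) 1)) = ![p (Pi.single (v 0) 1), p (Pi.single (v 1) 1)] := by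
      ext i; fin_cases i <;> rfl
    rw [e]
    have hne : v 0 ≠ v 1 := fun h => by simpa using hv h
    generalize v 0 = i at *
    generalize v 1 = j at *
    fin_cases i <;> fin_cases j <;> first
      | exact absurd rfl hne
      | (simp [toExteriorTwo, Fintype.linearCombination_apply, Fin.sum_univ_three, cross_apply]
         done)
      | (simp [toExteriorTwo, Fintype.linearCombination_apply, Fin.sum_univ_three, cross_apply]
         exact (swap _ _).symm)
  exact congr_fun (congr_arg DFunLike.coe h) v

theorem toExteriorTwo_surjective (hp : Function.Surjective p) :
    Function.Surjective (toExteriorTwo p) := by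
  rw [← LinearMap.range_eq_top, eq_top_iff, ← exteriorPower.ιMulti_span R 2 M, Submodule.span_le]
  rintro _ ⟨m, rfl⟩
  choose σ hσ using hp
  refine ⟨σ (m 0) ⨯₃ σ (m 1), (toExteriorTwo_cross p (σ ∘ m)).trans ?_⟩
  congr 1
  ext i
  exact hσ _

/-- The cross product modulo boundaries kills multiples of `a`, so it descends to `⋀²M` and shows
that nothing beyond the boundaries is killed. -/
theorem ker_toExteriorTwo {a : Fin 3 → R} (hp : Function.Surjective p)
    (ha : LinearMap.ker p = Submodule.span R {a}) :
    LinearMap.ker (toExteriorTwo p) = koszulBoundaries a := by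
  apply le_antisymm
  · obtain ⟨g, hg⟩ := exists_alternatingMap_comp_eq
      ((koszulBoundaries a).mkQ.compAlternatingMap crossAlternating) p hp (by
        intro v i hi
        rw [← LinearMap.mem_ker, ha, Submodule.mem_span_singleton] at hi
        obtain ⟨r, hr⟩ := hi
        simp only [LinearMap.compAlternatingMap_apply, crossAlternating_apply,
          Submodule.mkQ_apply, Submodule.Quotient.mk_eq_zero]
        fin_cases i
        · exact ⟨r • v 1, by rw [show v 0 = r • a from hr.symm]; simp⟩
        · refine ⟨-(r • v 0), ?_⟩
          rw [show v 1 = r • a from hr.symm, map_neg, map_smul, map_smul, ← smul_neg, cross_anticomm])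
    have h : exteriorPower.alternatingMapLinearEquiv g ∘ₗ toExteriorTwo p =
        (koszulBoundaries a).mkQ := by
      have hg' : ∀ x y, g ![p x, p y] = (koszulBoundaries a).mkQ (x ⨯₃ y) := by
        intro x y
        rw [← show crossAlternating ![x, y] = x ⨯₃ y from rfl, ← LinearMap.compAlternatingMap_apply, ← hg,
          AlternatingMap.compLinearMap_apply]
        congr 1
        ext i; fin_cases i <;> rfl
      refine (Pi.basisFun R (Fin 3)).ext fun i => ?_
      fin_cases i <;>
      · simp [toExteriorTwo, hg', cross_apply, -nsmul_eq_mul]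
        congr 1
        ext j
        fin_cases j <;> simp
    intro x hx
    have := LinearMap.congr_fun h x
    rw [LinearMap.comp_apply, hx, map_zero] at this
    exact (Submodule.Quotient.mk_eq_zero _).mp this.symm
  · rintro _ ⟨v, rfl⟩
    have := toExteriorTwo_cross p ![a, v]
    simp only [cons_val_zero, cons_val_one] at this
    rw [LinearMap.mem_ker, this]
    refine AlternatingMap.map_coord_zero _ 0 ?_
    have : a ∈ LinearMap.ker p := ha ▸ Submodule.mem_span_singleton_self a
    simpa using this

/-- The map `R → ⋀³M` identifying `R` with `⋀³R³`, followed by `⋀³ p`. -/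
noncomputable def toExteriorThree (p : (Fin 3 → R) →ₗ[R] M) : R →ₗ[R] ⋀[R]^3 M :=
  LinearMap.toSpanSingleton R _ (exteriorPower.ιMulti R 3 fun i => p (Pi.single i 1))

theorem detRowAlternating_single :
    detRowAlternating (fun i : Fin 3 => (Pi.single i 1 : Fin 3 → R)) = 1 := by
  have e : Matrix.of (fun i : Fin 3 => (Pi.single i 1 : Fin 3 → R)) = 1 := by
    ext i j
    simp [Matrix.one_apply, Pi.single_apply, eq_comm]
  exact (congr_arg det e).trans det_one

theorem toExteriorThree_det (p : (Fin 3 → R) →ₗ[R] M) (v : Matrix (Fin 3) (Fin 3) R) :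
    toExteriorThree p v.det = exteriorPower.ιMulti R 3 fun i => p (v i) := by
  have h : (toExteriorThree p).compAlternatingMap detRowAlternating =
      (exteriorPower.ιMulti R 3).compLinearMap p := by
    refine Module.Basis.ext_alternating (Pi.basisFun R (Fin 3)) fun v hv => ?_
    -- An injective index triple is a permutation, and both sides acquire its sign.
    let σ : Equiv.Perm (Fin 3) := Equiv.ofBijective v (Finite.injective_iff_bijective.1 hv)
    have e : (fun i => Pi.basisFun R (Fin 3) (v i)) = (fun i => Pi.single i 1) ∘ σ := by
      ext i
      simp [σ]
    rw [e, AlternatingMap.map_perm, AlternatingMap.map_perm, LinearMap.compAlternatingMap_apply,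
      detRowAlternating_single, toExteriorThree, LinearMap.toSpanSingleton_apply, one_smul]
    rfl
  exact congr_fun (congr_arg DFunLike.coe h) v

theorem toExteriorThree_surjective (hp : Function.Surjective p) :
    Function.Surjective (toExteriorThree p) := by
  rw [← LinearMap.range_eq_top, eq_top_iff, ← exteriorPower.ιMulti_span R 3 M, Submodule.span_le]
  rintro _ ⟨m, rfl⟩
  choose σ hσ using hp
  refine ⟨Matrix.det (Matrix.of (σ ∘ m)), (toExteriorThree_det p _).trans ?_⟩
  congr 1
  ext i
  exact hσ _

theorem det_mem_of_smul_row {a : Fin 3 → R} {v : Fin 3 → Fin 3 → R} {i : Fin 3} {r : R}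
    (h : r • a = v i) : Matrix.det v ∈ Ideal.span (Set.range a) := by
  rw [det_eq_sum_mul_adjugate_row v i, ← h]
  refine Ideal.sum_mem _ fun j _ => Ideal.mul_mem_right _ _ ?_
  exact Ideal.mul_mem_left _ _ (Ideal.subset_span ⟨j, rfl⟩)

/-- As in degree two, with the determinant modulo the entries of `a` as the map that descends. -/
theorem ker_toExteriorThree {a : Fin 3 → R} (hp : Function.Surjective p)
    (ha : LinearMap.ker p = Submodule.span R {a}) :
    LinearMap.ker (toExteriorThree p) = Ideal.span (Set.range a) := by
  apply le_antisymm
  · obtain ⟨g, hg⟩ := exists_alternatingMap_comp_eq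
      ((Ideal.span (Set.range a)).mkQ.compAlternatingMap detRowAlternating) p hp (by
        intro v i hi
        rw [← LinearMap.mem_ker, ha, Submodule.mem_span_singleton] at hi
        obtain ⟨r, hr⟩ := hi
        exact (Submodule.Quotient.mk_eq_zero _).mpr (det_mem_of_smul_row hr))
    have h : exteriorPower.alternatingMapLinearEquiv g ∘ₗ toExteriorThree p =
        (Ideal.span (Set.range a)).mkQ := by
      ext
      have := congr_fun (congr_arg DFunLike.coe hg) (fun i => Pi.single i 1)
      rw [AlternatingMap.compLinearMap_apply] at this
      simp only [toExteriorThree, LinearMap.comp_apply, LinearMap.toSpanSingleton_apply, one_smul,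
        exteriorPower.alternatingMapLinearEquiv_apply_ιMulti, this]
      rw [LinearMap.compAlternatingMap_apply, detRowAlternating_single]
    intro x hx
    have := LinearMap.congr_fun h x
    rw [LinearMap.comp_apply, hx, map_zero] at this
    exact (Submodule.Quotient.mk_eq_zero _).mp this.symm
  · have hpa : p a = 0 := LinearMap.mem_ker.mp (ha ▸ Submodule.mem_span_singleton_self a)
    rw [Ideal.span_le]
    rintro _ ⟨i, rfl⟩
    have : a i = Matrix.det ((1 : Matrix (Fin 3) (Fin 3) R).updateRow i a) := by
      fin_cases i <;> simp [det_fin_three, updateRow_apply]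
    rw [SetLike.mem_coe, LinearMap.mem_ker, this, toExteriorThree_det]
    exact AlternatingMap.map_coord_zero _ i (by simp [hpa])

/-- If `M = R³/(a)` then `⋀³M = R/(a 0, a 1, a 2)`. -/
noncomputable def exteriorThreeEquiv {a : Fin 3 → R} (hp : Function.Surjective p)
    (ha : LinearMap.ker p = Submodule.span R {a}) :
    (R ⧸ Ideal.span (Set.range a)) ≃ₗ[R] ⋀[R]^3 M :=
  (Submodule.quotEquivOfEq _ _ (ker_toExteriorThree hp ha).symm).trans
    ((toExteriorThree p).quotKerEquivOfSurjective (toExteriorThree_surjective hp))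

end ExteriorPowers

end SurfaceSing

/-! ### `Ext¹` and `Ext²` from a short exact sequence with projective middle term -/

namespace SurfaceSing

open CategoryTheory Abelian

universe u

section Ext

variable {R : Type u} [CommRing R] {K P M : Type u} [AddCommGroup K] [Module R K]
  [AddCommGroup P] [Module R P] [AddCommGroup M] [Module R M]

/-- The short complex of `R`-modules attached to an exact sequence `K → P → M`. -/
abbrev moduleShortComplex (i : K →ₗ[R] P) (p : P →ₗ[R] M) (h : Function.Exact i p) :
    ShortComplex (ModuleCat.{u} R) :=
  ShortComplex.mk (ModuleCat.ofHom i) (ModuleCat.ofHom p)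
    (by ext x; exact h.apply_apply_eq_zero x)

theorem moduleShortComplex_shortExact {i : K →ₗ[R] P} {p : P →ₗ[R] M}
    (hi : Function.Injective i) (h : Function.Exact i p) (hp : Function.Surjective p) :
    (moduleShortComplex i p h).ShortExact where
  exact := (ShortComplex.ShortExact.moduleCat_exact_iff_function_exact _).mpr h
  mono_f := (ModuleCat.mono_iff_injective _).mpr hi
  epi_g := (ModuleCat.epi_iff_surjective _).mpr hp

variable (N : Type u) [AddCommGroup N] [Module R N]

/-- The connecting map `Hom(K, N) → Ext¹(M, N)` of a short exact sequence. -/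
noncomputable def extConnecting {i : K →ₗ[R] P} {p : P →ₗ[R] M}
    (hi : Function.Injective i) (h : Function.Exact i p) (hp : Function.Surjective p) :
    (K →ₗ[R] N) →ₗ[R] Ext (ModuleCat.of R M) (ModuleCat.of R N) 1 :=
  Ext.precompOfLinear (moduleShortComplex_shortExact hi h hp).extClass R (ModuleCat.of R N)
      (add_zero 1) ∘ₗ
    (Ext.linearEquiv₀ (R := R) (X := ModuleCat.of R K) (Y := ModuleCat.of R N)).symm.toLinearMap ∘ₗ
    (ModuleCat.homLinearEquiv (S := R) (M := ModuleCat.of R K)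
      (N := ModuleCat.of R N)).symm.toLinearMap

theorem extConnecting_apply {i : K →ₗ[R] P} {p : P →ₗ[R] M}
    (hi : Function.Injective i) (h : Function.Exact i p) (hp : Function.Surjective p)
    (f : K →ₗ[R] N) :
    extConnecting N hi h hp f = (moduleShortComplex_shortExact hi h hp).extClass.comp
      (Ext.mk₀ (ModuleCat.ofHom f)) (add_zero 1) := rfl

variable [Module.Projective R P]

omit [Module.Projective R P] in
theorem ker_extConnecting {i : K →ₗ[R] P} {p : P →ₗ[R] M}
    (hi : Function.Injective i) (h : Function.Exact i p) (hp : Function.Surjective p) :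
    LinearMap.ker (extConnecting N hi h hp) = LinearMap.range (LinearMap.lcomp R N i) := by
  have hS := moduleShortComplex_shortExact hi h hp
  ext f
  rw [LinearMap.mem_ker, extConnecting_apply, LinearMap.mem_range]
  constructor
  · intro hf
    obtain ⟨x, hx⟩ := Ext.contravariant_sequence_exact₁ hS _ _ _ hf
    obtain ⟨g, rfl⟩ := Ext.homEquiv₀.symm.surjective x
    refine ⟨g.hom, ?_⟩
    rw [Ext.homEquiv₀_symm_apply, Ext.mk₀_comp_mk₀] at hx
    have := Ext.homEquiv₀.symm.injective hx
    exact congr_arg ModuleCat.Hom.hom this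
  · rintro ⟨g, rfl⟩
    have : Ext.mk₀ (ModuleCat.ofHom (LinearMap.lcomp R N i g)) =
        (Ext.mk₀ (moduleShortComplex i p h).f).comp (Ext.mk₀ (ModuleCat.ofHom g)) (zero_add 0) := by
      rw [Ext.mk₀_comp_mk₀]; rfl
    rw [this, ← Ext.comp_assoc _ _ _ (add_zero 1) (zero_add 0) (by simp)]
    erw [hS.extClass_comp]
    simp

theorem extConnecting_surjective {i : K →ₗ[R] P} {p : P →ₗ[R] M}
    (hi : Function.Injective i) (h : Function.Exact i p) (hp : Function.Surjective p) :
    Function.Surjective (extConnecting N hi h hp) := by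
  have hS := moduleShortComplex_shortExact hi h hp
  have : Projective (ModuleCat.of R P) := (IsProjective.iff_projective (R := R) P).mp inferInstance
  intro x
  obtain ⟨y, hy⟩ := Ext.contravariant_sequence_exact₃ hS _ x
    (Ext.eq_zero_of_projective _) (add_zero 1)
  obtain ⟨g, rfl⟩ := Ext.homEquiv₀.symm.surjective y
  exact ⟨g.hom, hy⟩

/-- `Ext¹(M, N)` is the cokernel of `Hom(P, N) → Hom(K, N)` for `0 → K → P → M → 0` exact with
`P` projective. -/
noncomputable def extOneEquiv {i : K →ₗ[R] P} {p : P →ₗ[R] M}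
    (hi : Function.Injective i) (h : Function.Exact i p) (hp : Function.Surjective p) :
    ((K →ₗ[R] N) ⧸ LinearMap.range (LinearMap.lcomp R N i)) ≃ₗ[R]
      Ext (ModuleCat.of R M) (ModuleCat.of R N) 1 :=
  (Submodule.quotEquivOfEq _ _ (ker_extConnecting N hi h hp).symm).trans
    ((extConnecting N hi h hp).quotKerEquivOfSurjective (extConnecting_surjective N hi h hp))

/-- Dimension shifting: `Ext¹(K, N) ≃ Ext²(M, N)` for `0 → K → P → M → 0` exact with `P`
projective. -/
noncomputable def extTwoEquiv {i : K →ₗ[R] P} {p : P →ₗ[R] M}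
    (hi : Function.Injective i) (h : Function.Exact i p) (hp : Function.Surjective p) :
    Ext (ModuleCat.of R K) (ModuleCat.of R N) 1 ≃ₗ[R]
      Ext (ModuleCat.of R M) (ModuleCat.of R N) 2 :=
  have : Projective (ModuleCat.of R P) := (IsProjective.iff_projective (R := R) P).mp inferInstance
  LinearEquiv.ofBijective
    (Ext.precompOfLinear (moduleShortComplex_shortExact hi h hp).extClass R (ModuleCat.of R N)
      (show 1 + 1 = 2 from rfl))
    ⟨(injective_iff_map_eq_zero _).mpr fun x hx => by
      obtain ⟨y, rfl⟩ := Ext.contravariant_sequence_exact₁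
        (moduleShortComplex_shortExact hi h hp) _ x rfl hx
      rw [Ext.eq_zero_of_projective y, Ext.comp_zero],
    fun x => Ext.contravariant_sequence_exact₃ (moduleShortComplex_shortExact hi h hp) _ x
      (Ext.eq_zero_of_projective _) rfl⟩

end Ext

end SurfaceSing

/-! ### Ext groups and torsion in terms of the Koszul complex -/

namespace SurfaceSing

open Matrix CategoryTheory

universe u

section KoszulExt

variable {R : Type u} [CommRing R] {M : Type u} [AddCommGroup M] [Module R M]
  {p : (Fin 3 → R) →ₗ[R] M} {a : Fin 3 → R}

theorem exact_toSpanSingleton (ha : LinearMap.ker p = Submodule.span R {a}) :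
    Function.Exact (LinearMap.toSpanSingleton R (Fin 3 → R) a) p := by
  rw [LinearMap.exact_iff, ha, LinearMap.range_toSpanSingleton]

theorem toSpanSingleton_injective (h0 : ∀ r : R, r • a = 0 → r = 0) :
    Function.Injective (LinearMap.toSpanSingleton R (Fin 3 → R) a) :=
  (injective_iff_map_eq_zero _).mpr h0

/-- `Ext¹(R³/(a), R) ≃ R/(a 0, a 1, a 2)` when `a` has zero annihilator. -/
noncomputable def extOneQuotientEquiv (hp : Function.Surjective p)
    (ha : LinearMap.ker p = Submodule.span R {a}) (h0 : ∀ r : R, r • a = 0 → r = 0) :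
    (R ⧸ Ideal.span (Set.range a)) ≃ₗ[R] Abelian.Ext (ModuleCat.of R M) (ModuleCat.of R R) 1 :=
  (Submodule.Quotient.equiv _ _ (LinearMap.ringLmapEquivSelf R R R) (by
    -- Restriction along `r ↦ r • a` sends `g` to `g a`, so the image of the dual of `R³` is the
    -- ideal of the entries of `a`.
    rw [← LinearMap.range_comp]
    apply le_antisymm
    · rintro _ ⟨g, rfl⟩
      have : g a = ∑ i, a i * g (Pi.single i 1) := by
        conv_lhs => rw [pi_eq_sum_univ' a, map_sum]
        simp
      simp only [LinearMap.comp_apply, LinearEquiv.coe_coe, LinearMap.ringLmapEquivSelf_apply,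
        LinearMap.lcomp_apply, LinearMap.toSpanSingleton_apply, one_smul, this]
      exact Ideal.sum_mem _ fun i _ => Ideal.mul_mem_right _ _ (Ideal.subset_span ⟨i, rfl⟩)
    · rw [Ideal.span, Submodule.span_le]
      rintro _ ⟨i, rfl⟩
      exact ⟨LinearMap.proj i, by simp⟩)).symm.trans
    (extOneEquiv R (toSpanSingleton_injective h0) (exact_toSpanSingleton ha) hp)

/-- The linear map on the target of a surjection `p` induced by one that vanishes on the kernel
of `p`. -/
noncomputable def descend {N Q : Type*} [AddCommGroup N] [Module R N] [AddCommGroup Q] [Module R Q]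
    {q : N →ₗ[R] M} (hq : Function.Surjective q) (g : N →ₗ[R] Q)
    (h : LinearMap.ker q ≤ LinearMap.ker g) : M →ₗ[R] Q :=
  (LinearMap.ker q).liftQ g h ∘ₗ (q.quotKerEquivOfSurjective hq).symm.toLinearMap

@[simp]
theorem descend_apply {N Q : Type*} [AddCommGroup N] [Module R N] [AddCommGroup Q] [Module R Q]
    {q : N →ₗ[R] M} (hq : Function.Surjective q) (g : N →ₗ[R] Q)
    (h : LinearMap.ker q ≤ LinearMap.ker g) (x : N) : descend hq g h (q x) = g x := by
  have : (q.quotKerEquivOfSurjective hq).symm (q x) = Submodule.Quotient.mk x :=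
    (LinearEquiv.symm_apply_eq _).mpr rfl
  simp [descend, this]

theorem span_le_ker_cross (ha : LinearMap.ker p = Submodule.span R {a}) :
    LinearMap.ker p ≤ LinearMap.ker (crossProduct a) := by
  rw [ha, Submodule.span_le, Set.singleton_subset_iff]
  exact cross_self a

/-- The map `R³/(a) → R³` induced by `v ↦ a ⨯₃ v`. -/
noncomputable def crossDescend (hp : Function.Surjective p)
    (ha : LinearMap.ker p = Submodule.span R {a}) : M →ₗ[R] (Fin 3 → R) :=
  descend hp (crossProduct a) (span_le_ker_cross ha)

@[simp]
theorem crossDescend_apply (hp : Function.Surjective p)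
    (ha : LinearMap.ker p = Submodule.span R {a}) (v : Fin 3 → R) :
    crossDescend hp ha (p v) = a ⨯₃ v := descend_apply _ _ _ _

theorem crossDescend_injective (hp : Function.Surjective p)
    (ha : LinearMap.ker p = Submodule.span R {a})
    (h1 : ∀ v : Fin 3 → R, a ⨯₃ v = 0 → ∃ r : R, r • a = v) :
    Function.Injective (crossDescend hp ha) := by
  refine (injective_iff_map_eq_zero _).mpr fun m hm => ?_
  obtain ⟨v, rfl⟩ := hp m
  rw [crossDescend_apply] at hm
  rw [← LinearMap.mem_ker, ha]
  exact Submodule.mem_span_singleton.mpr (h1 v hm)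

theorem exact_crossDescend {W : Type*} [AddCommGroup W] [Module R W] (hp : Function.Surjective p)
    (ha : LinearMap.ker p = Submodule.span R {a}) {q : (Fin 3 → R) →ₗ[R] W}
    (hq : LinearMap.ker q = koszulBoundaries a) :
    Function.Exact (crossDescend hp ha) q := by
  rw [LinearMap.exact_iff, hq]
  ext v
  constructor
  · rintro ⟨w, rfl⟩
    exact ⟨p w, by simp⟩
  · rintro ⟨m, rfl⟩
    obtain ⟨w, rfl⟩ := hp m
    exact ⟨w, by simp⟩

/-- The dual of `R³/(a)` is the module of vectors orthogonal to `a`. -/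
noncomputable def dualEquivCycles (hp : Function.Surjective p)
    (ha : LinearMap.ker p = Submodule.span R {a}) : (M →ₗ[R] R) ≃ₗ[R] koszulCycles a :=
  have hpa : p a = 0 := LinearMap.mem_ker.mp (ha ▸ Submodule.mem_span_singleton_self a)
  have key : ∀ (g : M →ₗ[R] R) (w : Fin 3 → R),
      w ⬝ᵥ (fun i => g (p (Pi.single i 1))) = g (p w) := fun g w => by
    conv_rhs => rw [pi_eq_sum_univ' w, map_sum, map_sum]
    simp [dotProduct]
  LinearEquiv.ofBijective
    (LinearMap.codRestrict (koszulCycles a)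
      (LinearMap.pi fun i => LinearMap.applyₗ (p (Pi.single i 1)))
      fun g => by
        rw [mem_koszulCycles]
        refine (key g a).trans ?_
        rw [hpa, map_zero])
    ⟨(injective_iff_map_eq_zero _).mpr fun g hg => by
      ext m
      obtain ⟨w, rfl⟩ := hp m
      rw [← key, show (fun i => g (p (Pi.single i 1))) = 0 from congr_arg Subtype.val hg]
      simp, fun v => by
      refine ⟨descend hp (dotForm v) ?_, ?_⟩
      · rw [ha, Submodule.span_le, Set.singleton_subset_iff, SetLike.mem_coe, LinearMap.mem_ker,
          dotForm_apply, dotProduct_comm]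
        exact v.2
      · ext i
        simp⟩

theorem dualEquivCycles_apply (hp : Function.Surjective p)
    (ha : LinearMap.ker p = Submodule.span R {a}) (g : M →ₗ[R] R) (i : Fin 3) :
    (dualEquivCycles hp ha g : Fin 3 → R) i = g (p (Pi.single i 1)) := rfl

/-- `Ext¹(W, R) ≃ H²` of the Koszul complex of `a`, for `W = R³/(a ⨯₃ R³)`, when this complex is
exact at the second place. -/
noncomputable def extOneEquivKoszulH2 {W : Type u} [AddCommGroup W] [Module R W]
    (hp : Function.Surjective p)
    (ha : LinearMap.ker p = Submodule.span R {a})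
    (h1 : ∀ v : Fin 3 → R, a ⨯₃ v = 0 → ∃ r : R, r • a = v) {q : (Fin 3 → R) →ₗ[R] W}
    (hq : Function.Surjective q) (hq' : LinearMap.ker q = koszulBoundaries a) :
    KoszulH2 a ≃ₗ[R] Abelian.Ext (ModuleCat.of R W) (ModuleCat.of R R) 1 :=
  (Submodule.Quotient.equiv _ _ (dualEquivCycles hp ha) (by
    -- If `γ` is the coefficient vector of `g`, the triple product identity gives `γ ⬝ᵥ (a ⨯₃ eᵢ) =
    -- -(a ⨯₃ γ) i`, whence the sign.
    have hval : ∀ g : (Fin 3 → R) →ₗ[R] R,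
        (dualEquivCycles hp ha (LinearMap.lcomp R R (crossDescend hp ha) g) : Fin 3 → R) =
          a ⨯₃ (-fun i => g (Pi.single i 1)) := by
      intro g
      have hg : ∀ w : Fin 3 → R, g w = ∑ i, w i * g (Pi.single i 1) := fun w => by
        conv_lhs => rw [pi_eq_sum_univ' w, map_sum]
        simp
      ext i
      rw [dualEquivCycles_apply, LinearMap.lcomp_apply, crossDescend_apply, hg,
        Fin.sum_univ_three]
      fin_cases i <;> simp [cross_apply] <;> ring
    apply le_antisymm
    · rintro _ ⟨_, ⟨g, rfl⟩, rfl⟩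
      exact ⟨_, (hval g).symm⟩
    · rintro ⟨_, hv⟩ ⟨w, rfl⟩
      refine ⟨_, ⟨dotForm (-w), rfl⟩, Subtype.ext ?_⟩
      refine (hval _).trans ?_
      congr 1
      ext i
      simp)).symm.trans
    (extOneEquiv R (crossDescend_injective hp ha h1) (exact_crossDescend hp ha hq') hq)

/-- `Ext¹(R³/(a), R) ≃ Ext²(W, R)` for `W = R³/(a ⨯₃ R³)`, when the Koszul complex of `a` is
exact at the second place. -/
noncomputable def extOneEquivExtTwo {W : Type u} [AddCommGroup W] [Module R W]
    (hp : Function.Surjective p)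
    (ha : LinearMap.ker p = Submodule.span R {a})
    (h1 : ∀ v : Fin 3 → R, a ⨯₃ v = 0 → ∃ r : R, r • a = v) {q : (Fin 3 → R) →ₗ[R] W}
    (hq : Function.Surjective q) (hq' : LinearMap.ker q = koszulBoundaries a) :
    Abelian.Ext (ModuleCat.of R M) (ModuleCat.of R R) 1 ≃ₗ[R]
      Abelian.Ext (ModuleCat.of R W) (ModuleCat.of R R) 2 :=
  extTwoEquiv R (crossDescend_injective hp ha h1) (exact_crossDescend hp ha hq') hq

/-- The torsion of `W = R³/(a ⨯₃ R³)` is `H²` of the Koszul complex of `a`, when some linear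
combination of the entries of `a` is a non-zero-divisor. -/
noncomputable def koszulH2EquivTorsion {W : Type*} [AddCommGroup W] [Module R W]
    {q : (Fin 3 → R) →ₗ[R] W}
    (hq : Function.Surjective q) (hq' : LinearMap.ker q = koszulBoundaries a)
    (hc : ∃ w : Fin 3 → R, a ⬝ᵥ w ∈ nonZeroDivisors R) :
    KoszulH2 a ≃ₗ[R] Submodule.torsion R W :=
  (Submodule.quotEquivOfEq _ _ (by
    rw [LinearMap.ker_comp, hq']; rfl)).trans
    ((q ∘ₗ (koszulCycles a).subtype).quotKerEquivRange.trans
      (LinearEquiv.ofEq _ _ (by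
        apply le_antisymm
        · rintro _ ⟨⟨v, hv⟩, rfl⟩
          obtain ⟨w, hw⟩ := hc
          refine (Submodule.mem_torsion_iff _).mpr ⟨⟨_, hw⟩, ?_⟩
          change (a ⬝ᵥ w) • q v = 0
          rw [← map_smul, ← LinearMap.mem_ker, hq']
          -- For a cycle `v`, `a ⨯₃ (v ⨯₃ w) = (a ⬝ᵥ w) • v`: the entries of `a` annihilate `H²`.
          refine ⟨v ⨯₃ w, ?_⟩
          rw [cross_cross_eq_smul_sub_smul', dotProduct_comm v a, mem_koszulCycles.mp hv,
            zero_smul, sub_zero]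
        · intro x hx
          obtain ⟨v, rfl⟩ := hq x
          obtain ⟨⟨r, hr⟩, hrv⟩ := (Submodule.mem_torsion_iff _).mp hx
          change r • q v = 0 at hrv
          rw [← map_smul, ← LinearMap.mem_ker, hq'] at hrv
          have := koszulBoundaries_le_koszulCycles a hrv
          rw [mem_koszulCycles, dotProduct_smul, smul_eq_mul] at this
          exact ⟨⟨v, (mul_left_mem_nonZeroDivisors_eq_zero_iff hr).mp this⟩, rfl⟩)))

end KoszulExt

end SurfaceSing

/-! ### The presentation of `Ω¹` by the gradient -/

namespace SurfaceSing

open MvPolynomial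

universe u

section Differentials

variable {F : Type u} [Field F] (f : MvPolynomial (Fin 3) F)

/-- The vector of partial derivatives of `f` in `R³`, where `R = F[x,y,z]/(f)`. -/
noncomputable def gradient (i : Fin 3) : HypersurfaceRing f :=
  Ideal.Quotient.mk (Ideal.span {f}) (pderiv i f)

theorem jacobianIdeal_eq : jacobianIdeal f = Ideal.span (Set.range (gradient f)) := rfl

/-- The surjection `R³ → Ω¹_R` given by `dx, dy, dz`. -/
noncomputable def toDifferentials :
    (Fin 3 → HypersurfaceRing f) →ₗ[HypersurfaceRing f] Ω[HypersurfaceRing f⁄F] :=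
  Fintype.linearCombination _ fun i =>
    KaehlerDifferential.D F (HypersurfaceRing f) (algebraMap (MvPolynomial (Fin 3) F) _ (X i))

theorem map_eq_toDifferentials (ω : Ω[MvPolynomial (Fin 3) F⁄F]) :
    KaehlerDifferential.map F F (MvPolynomial (Fin 3) F) (HypersurfaceRing f) ω =
      toDifferentials f fun i =>
        Ideal.Quotient.mk _ ((KaehlerDifferential.mvPolynomialBasis F (Fin 3)).repr ω i) := by
  conv_lhs => rw [← (KaehlerDifferential.mvPolynomialBasis F (Fin 3)).sum_repr ω, map_sum]
  simp [toDifferentials, Fintype.linearCombination_apply, KaehlerDifferential.mvPolynomialBasis_apply,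
    KaehlerDifferential.map_D]
  exact Finset.sum_congr rfl fun i _ => (algebraMap_smul (HypersurfaceRing f) _ _).symm

theorem toDifferentials_surjective : Function.Surjective (toDifferentials f) := by
  intro x
  obtain ⟨ω, rfl⟩ := KaehlerDifferential.map_surjective_of_surjective F F
    (MvPolynomial (Fin 3) F) (HypersurfaceRing f) Ideal.Quotient.mk_surjective x
  exact ⟨_, (map_eq_toDifferentials f ω).symm⟩

/-- The map `Ω¹_S → R³`, `S = F[x,y,z]`, reducing coefficients modulo `f`. -/
noncomputable def reduceDifferentials :
    Ω[MvPolynomial (Fin 3) F⁄F] →ₗ[MvPolynomial (Fin 3) F] (Fin 3 → HypersurfaceRing f) :=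
  LinearMap.pi fun i =>
    (Algebra.linearMap (MvPolynomial (Fin 3) F) (HypersurfaceRing f)) ∘ₗ
      (KaehlerDifferential.mvPolynomialBasis F (Fin 3)).coord i

theorem reduceDifferentials_D (g : MvPolynomial (Fin 3) F) (i : Fin 3) :
    reduceDifferentials f (KaehlerDifferential.D F _ g) i =
      Ideal.Quotient.mk _ (pderiv i g) := by
  simp [reduceDifferentials]

/-- This is the conormal sequence: relations among `dx, dy, dz` come from `d(g f)`, which equals `g
df` modulo `f`. -/
theorem ker_toDifferentials :
    LinearMap.ker (toDifferentials f) = Submodule.span (HypersurfaceRing f) {gradient f} := by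
  apply le_antisymm
  · intro v hv
    let t : TensorProduct (MvPolynomial (Fin 3) F) (HypersurfaceRing f)
        Ω[MvPolynomial (Fin 3) F⁄F] :=
      ∑ i, v i ⊗ₜ KaehlerDifferential.D F (MvPolynomial (Fin 3) F) (X i)
    have ht : KaehlerDifferential.mapBaseChange F (MvPolynomial (Fin 3) F)
        (HypersurfaceRing f) t = 0 := by
      rw [LinearMap.mem_ker] at hv
      rw [← hv]
      simp [t, toDifferentials, Fintype.linearCombination_apply]
    obtain ⟨y, hy⟩ := (KaehlerDifferential.exact_kerCotangentToTensor_mapBaseChange F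
      (MvPolynomial (Fin 3) F) (HypersurfaceRing f) Ideal.Quotient.mk_surjective t).mp ht
    obtain ⟨⟨x, hx⟩, rfl⟩ := Ideal.toCotangent_surjective _ y
    have hx' : x ∈ Ideal.span {f} := Ideal.Quotient.eq_zero_iff_mem.mp hx
    obtain ⟨g, rfl⟩ := Ideal.mem_span_singleton'.mp hx'
    rw [KaehlerDifferential.kerCotangentToTensor_toCotangent] at hy
    have h := congr_arg ((TensorProduct.isBaseChange (MvPolynomial (Fin 3) F)
      Ω[MvPolynomial (Fin 3) F⁄F] (HypersurfaceRing f)).lift (reduceDifferentials f)) hy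
    refine Submodule.mem_span_singleton.mpr ⟨Ideal.Quotient.mk _ g, ?_⟩
    have hf : Ideal.Quotient.mk (Ideal.span {f}) f = 0 :=
      Ideal.Quotient.eq_zero_iff_mem.mpr (Ideal.mem_span_singleton_self f)
    ext i
    have hi := congr_fun h i
    have e : ∀ (r : HypersurfaceRing f) (ω : Ω[MvPolynomial (Fin 3) F⁄F]),
      (TensorProduct.isBaseChange (MvPolynomial (Fin 3) F)
      Ω[MvPolynomial (Fin 3) F⁄F] (HypersurfaceRing f)).lift (reduceDifferentials f) (r ⊗ₜ ω) =
      r • reduceDifferentials f ω := by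
      intro r ω
      have hr : (r ⊗ₜ ω : TensorProduct (MvPolynomial (Fin 3) F) (HypersurfaceRing f)
          Ω[MvPolynomial (Fin 3) F⁄F]) = r • (1 ⊗ₜ ω) := by
        rw [TensorProduct.smul_tmul', smul_eq_mul, mul_one]
      rw [hr, map_smul]
      congr 1
      exact (TensorProduct.isBaseChange _ _ _).lift_eq _ _
    simp only [t, map_sum, e, Finset.sum_apply, Pi.smul_apply, reduceDifferentials_D] at hi
    simp only [Derivation.leibniz, smul_eq_mul, map_add, map_mul, hf, zero_mul, add_zero, one_mul,
      pderiv_X] at hi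
    simp only [Pi.smul_apply, smul_eq_mul, gradient, hi]
    rw [Finset.sum_eq_single i]
    · simp
    · intro j _ hj
      simp [hj.symm]
    · simp
  · rw [Submodule.span_le, Set.singleton_subset_iff, SetLike.mem_coe, LinearMap.mem_ker]
    have := map_eq_toDifferentials f (KaehlerDifferential.D F _ f)
    simp only [KaehlerDifferential.mvPolynomialBasis_repr_apply, KaehlerDifferential.map_D] at this
    have hf : algebraMap (MvPolynomial (Fin 3) F) (HypersurfaceRing f) f = 0 :=
      Ideal.Quotient.eq_zero_iff_mem.mpr (Ideal.mem_span_singleton_self f)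
    rw [hf, map_zero] at this
    exact this.symm

end Differentials

end SurfaceSing

/-! ### Depth at the origin, prime avoidance and dimension -/

namespace SurfaceSing

open MvPolynomial Matrix

universe u

section Regularity

variable {F : Type u} [Field F]

theorem isRegularPair_X : IsRegularPair (X : Fin 3 → MvPolynomial (Fin 3) F) where
  fst r h := (mul_eq_zero.mp h).resolve_left (X_ne_zero 0)
  snd r s h := by
    have h0 : (X 0 : MvPolynomial (Fin 3) F) ∣ X 1 * r := ⟨s, h⟩
    refine ((X_prime (i := (0 : Fin 3))).dvd_or_dvd h0).resolve_left fun h => ?_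
    simp [X_dvd_X] at h

/-- By the monomial description of `(x, y)`, `z` is a non-zero-divisor modulo it; hence the Koszul
complex of `x, y, z` is exact at the third place too. -/
theorem exists_cross_eq_of_dot_eq_zero {r : Fin 3 → MvPolynomial (Fin 3) F}
    (h : (X : Fin 3 → MvPolynomial (Fin 3) F) ⬝ᵥ r = 0) :
    ∃ u, (X : Fin 3 → MvPolynomial (Fin 3) F) ⨯₃ u = r := by
  refine isRegularPair_X.mem_koszulBoundaries h ?_
  have key : ∀ q : MvPolynomial (Fin 3) F,
      q ∈ Ideal.span {X 0, X 1} ↔ ∀ m ∈ q.support, m 0 ≠ 0 ∨ m 1 ≠ 0 := by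
    intro q
    have := mem_ideal_span_X_image (R := F) (x := q) (s := {0, 1})
    rw [Set.image_pair] at this
    simp [this]
  have hz : X 2 * r 2 ∈ Ideal.span {(X 0 : MvPolynomial (Fin 3) F), X 1} := by
    refine Ideal.mem_span_pair.mpr ⟨-r 0, -r 1, ?_⟩
    simp only [dotProduct, Fin.sum_univ_three] at h
    linear_combination -h
  rw [key] at hz ⊢
  intro m hm
  have := hz (Finsupp.single 2 1 + m) (by rw [support_X_mul]; simpa using hm)
  simpa using this

theorem dvd_of_forall_dvd_X_mul {f s : MvPolynomial (Fin 3) F} (hf : f ≠ 0)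
    (h : ∀ i, f ∣ X i * s) : f ∣ s := by
  obtain ⟨p, hp⟩ := h 0
  obtain ⟨q, hq⟩ := h 1
  obtain ⟨t, rfl⟩ := isRegularPair_X.snd p q (mul_left_cancel₀ hf (by
    linear_combination X 0 * hq - X 1 * hp))
  exact ⟨t, mul_left_cancel₀ (X_ne_zero 0) (by rw [hp]; ring)⟩

/-- The ideal `(x, y, z)` is not associated to a complete intersection `(f, g)` in `F[x,y,z]`. -/
theorem mem_span_pair_of_forall_X_mul_mem {f g s : MvPolynomial (Fin 3) F} (hf : f ≠ 0)
    (hg : ∀ q, f ∣ g * q → f ∣ q) (h : ∀ i, X i * s ∈ Ideal.span {f, g}) :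
    s ∈ Ideal.span {f, g} := by
  let x : Fin 3 → MvPolynomial (Fin 3) F := X
  have h' : ∀ i, ∃ p q, p * f + q * g = x i * s := fun i => Ideal.mem_span_pair.mp (h i)
  choose p q hpq using h'
  have hsum : f • (x ⨯₃ p) + g • (x ⨯₃ q) = 0 := by
    have : f • p + g • q = s • x := by
      ext1 i
      simp only [Pi.add_apply, Pi.smul_apply, smul_eq_mul]
      linear_combination hpq i
    rw [← map_smul, ← map_smul, ← map_add, this, map_smul, cross_self, smul_zero]
  have hdvd : ∀ i, f ∣ (x ⨯₃ q) i := fun i => hg _ ⟨-(x ⨯₃ p) i, by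
    have := congr_fun hsum i
    simp only [Pi.add_apply, Pi.smul_apply, smul_eq_mul, Pi.zero_apply] at this
    linear_combination this⟩
  choose r hr using hdvd
  have hq : x ⨯₃ q = f • r := by
    ext1 i
    simp [hr]
  have hp : x ⨯₃ p = -(g • r) := by
    rw [hq, smul_comm, ← smul_add] at hsum
    exact eq_neg_of_add_eq_zero_left ((smul_eq_zero.mp hsum).resolve_left hf)
  have hxr : x ⬝ᵥ r = 0 := by
    have := dot_self_cross x q
    rw [hq, dotProduct_smul, smul_eq_mul] at this
    exact (mul_eq_zero.mp this).resolve_left hf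
  -- The correction by `u` makes `p + g • u` and `q - f • u` multiples `v • x` and `w • x`, so that
  -- `s = v * f + w * g`.
  obtain ⟨u, hu⟩ := exists_cross_eq_of_dot_eq_zero hxr
  change x ⨯₃ u = r at hu
  obtain ⟨v, hv⟩ := isRegularPair_X.exists_smul_of_cross_eq_zero (v := p + g • u) (by
    change x ⨯₃ _ = 0
    rw [map_add, map_smul, hp, hu, neg_add_cancel])
  obtain ⟨w, hw⟩ := isRegularPair_X.exists_smul_of_cross_eq_zero (v := q - f • u) (by
    change x ⨯₃ _ = 0
    rw [map_sub, map_smul, hq, hu, sub_self])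
  refine Ideal.mem_span_pair.mpr ⟨v, w, mul_left_cancel₀ (X_ne_zero (R := F) (0 : Fin 3)) ?_⟩
  have hv0 := congr_fun hv 0
  have hw0 := congr_fun hw 0
  have h0 := hpq 0
  simp only [Pi.add_apply, Pi.sub_apply, Pi.smul_apply, smul_eq_mul, x] at hv0 hw0 h0
  linear_combination h0 + f * hv0 + g * hw0

/-- Over an infinite field, a linear system that is contained in no associated prime of `N`
has a member outside any given proper subspace that is regular on `N`. -/
theorem exists_isSMulRegular_of_forall_associatedPrimes {R V : Type*} [CommRing R]
    [IsNoetherianRing R] [Infinite F] [Algebra F R] [AddCommGroup V] [Module F V]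
    (L : V →ₗ[F] R) (N : Type*) [AddCommGroup N] [Module R N] [Module.Finite R N]
    (hL : ∀ I ∈ associatedPrimes R N, ∃ c, L c ∉ I) (W : Submodule F V) (hW : W ≠ ⊤) :
    ∃ c, c ∉ W ∧ IsSMulRegular N (L c) := by
  classical
  -- A vector space over an infinite field is not a finite union of proper subspaces; these are `W`
  -- and the preimages of the associated primes.
  let S : Finset (Submodule F V) :=
    insert W ((associatedPrimes.finite R N).toFinset.image
      fun I => (I.restrictScalars F).comap L)
  have hS : ⊤ ∉ S := by
    simp only [S, Finset.mem_insert, Finset.mem_image, Set.Finite.mem_toFinset, not_or, not_exists,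
      not_and]
    refine ⟨hW.symm, fun I hI h => ?_⟩
    obtain ⟨c, hc⟩ := hL I hI
    have : c ∈ (I.restrictScalars F).comap L := h ▸ Submodule.mem_top
    exact hc this
  obtain ⟨c, hc⟩ := (Set.ne_univ_iff_exists_notMem _).mp (Subspace.biUnion_ne_univ_of_top_notMem hS)
  simp only [Set.mem_iUnion, not_exists] at hc
  refine ⟨c, hc W (Finset.mem_insert_self _ _), ?_⟩
  by_contra h
  have : L c ∈ ⋃ I ∈ associatedPrimes R N, (I : Set R) := by
    rw [biUnion_associatedPrimes_eq_compl_regular]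
    exact h
  simp only [Set.mem_iUnion] at this
  obtain ⟨I, hI, hcI⟩ := this
  exact hc ((I.restrictScalars F).comap L) (Finset.mem_insert_of_mem (Finset.mem_image.mpr
    ⟨I, (associatedPrimes.finite R N).mem_toFinset.mpr hI, rfl⟩)) hcI

variable {f : MvPolynomial (Fin 3) F}

theorem originIdeal_notMem_associatedPrimes (hf : f ≠ 0) :
    originIdeal f ∉ associatedPrimes (HypersurfaceRing f) (HypersurfaceRing f) := by
  intro h
  obtain ⟨hprime, x, hx⟩ := isAssociatedPrime_iff.mp h
  obtain ⟨s, rfl⟩ := Ideal.Quotient.mk_surjective x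
  have hs : f ∣ s := dvd_of_forall_dvd_X_mul hf fun i => by
    have : Ideal.Quotient.mk (Ideal.span {f}) (X i) ∈ originIdeal f := Ideal.subset_span ⟨i, rfl⟩
    rw [hx, Submodule.mem_colon_singleton, Submodule.mem_bot, smul_eq_mul, ← map_mul,
      Ideal.Quotient.eq_zero_iff_mem, Ideal.mem_span_singleton] at this
    exact this
  have h0 : Ideal.Quotient.mk (Ideal.span {f}) s = 0 :=
    Ideal.Quotient.eq_zero_iff_mem.mpr (Ideal.mem_span_singleton.mpr hs)
  refine hprime.ne_top ((Ideal.eq_top_iff_one _).mpr ?_)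
  rw [hx, h0, Submodule.mem_colon_singleton, smul_zero]
  exact zero_mem _

theorem originIdeal_notMem_associatedPrimes_quotient (hf : f ≠ 0) {b : HypersurfaceRing f}
    (hb : IsSMulRegular (HypersurfaceRing f) b) :
    originIdeal f ∉ associatedPrimes (HypersurfaceRing f) (HypersurfaceRing f ⧸ Ideal.span {b}) := by
  intro h
  obtain ⟨hprime, x, hx⟩ := isAssociatedPrime_iff.mp h
  obtain ⟨s', rfl⟩ := Submodule.Quotient.mk_surjective _ x
  obtain ⟨s, rfl⟩ := Ideal.Quotient.mk_surjective s'
  obtain ⟨g, rfl⟩ := Ideal.Quotient.mk_surjective b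
  have hmem : ∀ t, Ideal.Quotient.mk (Ideal.span {f}) t ∈
      Ideal.span {Ideal.Quotient.mk (Ideal.span {f}) g} ↔ t ∈ Ideal.span {f, g} := by
    intro t
    rw [Ideal.mem_span_singleton', Ideal.mem_span_pair]
    constructor
    · rintro ⟨a', ha⟩
      obtain ⟨c, rfl⟩ := Ideal.Quotient.mk_surjective a'
      rw [← map_mul, Ideal.Quotient.eq, Ideal.mem_span_singleton'] at ha
      obtain ⟨d, hd⟩ := ha
      exact ⟨-d, c, by linear_combination -hd⟩
    · rintro ⟨c, d, rfl⟩
      refine ⟨Ideal.Quotient.mk _ d, ?_⟩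
      rw [← map_mul, Ideal.Quotient.eq, Ideal.mem_span_singleton']
      exact ⟨-c, by ring⟩
  have hg : ∀ q, f ∣ g * q → f ∣ q := fun q hq => by
    rw [← Ideal.mem_span_singleton, ← Ideal.Quotient.eq_zero_iff_mem] at hq ⊢
    rw [map_mul] at hq
    exact hb.right_eq_zero_of_smul hq
  have hs : s ∈ Ideal.span {f, g} := mem_span_pair_of_forall_X_mul_mem hf hg fun i => by
    have : Ideal.Quotient.mk (Ideal.span {f}) (X i) ∈ originIdeal f := Ideal.subset_span ⟨i, rfl⟩
    rw [hx, Submodule.mem_colon_singleton, Submodule.mem_bot, ← Submodule.Quotient.mk_smul,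
      Submodule.Quotient.mk_eq_zero, smul_eq_mul, ← map_mul, hmem] at this
    exact this
  rw [← hmem, ← Submodule.Quotient.mk_eq_zero] at hs
  refine hprime.ne_top ((Ideal.eq_top_iff_one _).mpr ?_)
  rw [hx, hs, Submodule.mem_colon_singleton, smul_zero]
  exact zero_mem _

/-- In a Noetherian ring of dimension at most two, the quotient by a regular pair is Artinian. -/
theorem IsRegularPair.isArtinianRing_quotient {R : Type*} [CommRing R] [IsNoetherianRing R]
    (d2 : ringKrullDim R + 1 ≤ 3) {b : Fin 3 → R}
    (hb : IsRegularPair b) : IsArtinianRing (R ⧸ Ideal.span {b 0, b 1}) := by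
  have hb0 : b 0 ∈ nonZeroDivisors (R) :=
    mem_nonZeroDivisors_iff_right.mpr fun r hr => hb.fst r (by rw [mul_comm, hr])
  have d1 := ringKrullDim_succ_le_of_surjective (Ideal.Quotient.mk (Ideal.span {b 0}))
    Ideal.Quotient.mk_surjective hb0
    (Ideal.Quotient.eq_zero_iff_mem.mpr (Ideal.mem_span_singleton_self _))
  have hb1 : Ideal.Quotient.mk (Ideal.span {b 0}) (b 1) ∈
      nonZeroDivisors (R ⧸ Ideal.span {b 0}) := by
    refine mem_nonZeroDivisors_iff_right.mpr fun x hx => ?_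
    obtain ⟨r, rfl⟩ := Ideal.Quotient.mk_surjective x
    rw [← map_mul, Ideal.Quotient.eq_zero_iff_mem, Ideal.mem_span_singleton'] at hx
    obtain ⟨s, hs⟩ := hx
    obtain ⟨t, rfl⟩ := hb.snd r s (by linear_combination -hs)
    exact Ideal.Quotient.eq_zero_iff_mem.mpr
      (Ideal.mul_mem_right _ _ (Ideal.mem_span_singleton_self _))
  have hle : Ideal.span {b 0} ≤ Ideal.span {b 0, b 1} := Ideal.span_mono (by simp)
  have d0 := ringKrullDim_succ_le_of_surjective (Ideal.Quotient.factor hle)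
    (Ideal.Quotient.factor_surjective hle) hb1 (by
      rw [Ideal.Quotient.factor_mk]
      exact Ideal.Quotient.eq_zero_iff_mem.mpr (Ideal.subset_span (by simp)))
  have hd : ringKrullDim (R ⧸ Ideal.span {b 0, b 1}) ≤ 0 := by
    have h : ringKrullDim (R ⧸ Ideal.span {b 0, b 1}) + 3 ≤ 3 := by
      calc _ = ringKrullDim (R ⧸ Ideal.span {b 0, b 1}) + 1 + 1 + 1 := by
            rw [add_assoc, add_assoc]; norm_num
        _ ≤ ringKrullDim (R ⧸ Ideal.span {b 0}) + 1 + 1 := by gcongr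
        _ ≤ ringKrullDim (R) + 1 := by gcongr
        _ ≤ 3 := d2
    generalize ringKrullDim (R ⧸ Ideal.span {b 0, b 1}) = d at h
    induction d using WithBot.recBotCoe with
    -- The pair may generate the unit ideal, and the zero ring has dimension `⊥`.
    | bot => exact bot_le
    | coe d =>
      induction d using ENat.recTopCoe with
      | top => exact absurd h (by decide)
      | coe n =>
        have h' : (n : ℕ∞) + 3 ≤ 3 := WithBot.coe_le_coe.mp h
        have : n + 3 ≤ 3 := by exact_mod_cast h'
        have : n = 0 := by omega
        simp [this]
  have : Ring.KrullDimLE 0 (R ⧸ Ideal.span {b 0, b 1}) :=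
    (Order.krullDimLE_iff 0 _).mpr (by exact_mod_cast hd)
  exact IsNoetherianRing.isArtinianRing_of_krullDimLE_zero

theorem ringKrullDim_hypersurfaceRing_add_one_le (hf : f ≠ 0) :
    ringKrullDim (HypersurfaceRing f) + 1 ≤ 3 := by
  have d3 : ringKrullDim (MvPolynomial (Fin 3) F) = 3 := by
    simp
  exact (ringKrullDim_succ_le_of_surjective (Ideal.Quotient.mk (Ideal.span {f}))
    Ideal.Quotient.mk_surjective (mem_nonZeroDivisors_of_ne_zero hf)
    (Ideal.Quotient.eq_zero_iff_mem.mpr (Ideal.mem_span_singleton_self f))).trans d3.le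

/-- If the origin is the only point at which all entries of `a` vanish, then suitable
`F`-linear combinations of these entries start with a regular pair. -/
theorem exists_isRegularPair_mulVec [Infinite F] (hf : f ≠ 0) (a : Fin 3 → HypersurfaceRing f)
    (ha : ∀ I : Ideal (HypersurfaceRing f), I.IsPrime → (∀ i, a i ∈ I) → I = originIdeal f) :
    ∃ P : Matrix (Fin 3) (Fin 3) (HypersurfaceRing f), IsUnit P.det ∧ IsRegularPair (P *ᵥ a) := by
  let L : (Fin 3 → F) →ₗ[F] HypersurfaceRing f := Fintype.linearCombination F a
  have hL : ∀ (N : Type u) [AddCommGroup N] [Module (HypersurfaceRing f) N],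
      originIdeal f ∉ associatedPrimes (HypersurfaceRing f) N →
      ∀ I ∈ associatedPrimes (HypersurfaceRing f) N, ∃ c, L c ∉ I := by
    intro N _ _ hN I hI
    by_contra! h
    refine hN (ha I hI.1 (fun i => ?_) ▸ hI)
    simpa [L] using h (Pi.single i 1)
  have hdim : Module.finrank F (Fin 3 → F) = 3 := by simp
  obtain ⟨c0, hc0, hr0⟩ := exists_isSMulRegular_of_forall_associatedPrimes L (HypersurfaceRing f)
    (hL _ (originIdeal_notMem_associatedPrimes hf)) ⊥ bot_ne_top
  obtain ⟨c1, hc1, hr1⟩ := exists_isSMulRegular_of_forall_associatedPrimes L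
    (HypersurfaceRing f ⧸ Ideal.span {L c0})
    (hL _ (originIdeal_notMem_associatedPrimes_quotient hf hr0)) (Submodule.span F {c0}) (by
      intro h
      have := finrank_span_le_card (R := F) ({c0} : Set (Fin 3 → F))
      rw [h, finrank_top, hdim] at this
      simp at this)
  obtain ⟨c2, -, hc2⟩ := SetLike.exists_of_lt (show Submodule.span F {c1, c0} < ⊤ from by
    refine lt_top_iff_ne_top.mpr fun h => ?_
    classical
    have := finrank_span_finset_le_card (R := F) ({c1, c0} : Finset (Fin 3 → F))
    rw [Set.finrank, Finset.coe_pair, h, finrank_top, hdim] at this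
    exact absurd (this.trans Finset.card_le_two) (by norm_num))
  have hli : LinearIndependent F ![c2, c0, c1] := by
    refine LinearIndependent.finCons (v := ![c0, c1]) ?_ ?_
    · refine (LinearIndependent.pair_iff' (by simpa using hc0)).mpr fun t ht => hc1 ?_
      exact Submodule.mem_span_singleton.mpr ⟨t, ht⟩
    · rwa [Matrix.range_cons, Matrix.range_cons, Matrix.range_empty, Set.union_empty,
        Set.singleton_union, Set.pair_comm]
  let Q : Matrix (Fin 3) (Fin 3) F := Matrix.of ![c0, c1, c2]
  refine ⟨Q.map (algebraMap F (HypersurfaceRing f)), ?_, ?_⟩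
  · rw [← RingHom.mapMatrix_apply, ← RingHom.map_det]
    refine IsUnit.map _ ((Matrix.isUnit_iff_isUnit_det Q).mp
      (Matrix.linearIndependent_rows_iff_isUnit.mp ?_))
    -- `finCons` put `c2` first; this restores the order `c0, c1, c2`.
    convert hli.comp ![1, 2, 0] (by decide) using 1
    ext i j
    fin_cases i <;> rfl
  · have hQ : ∀ i, (Q.map (algebraMap F (HypersurfaceRing f)) *ᵥ a) i = L (Q i) := by
      intro i
      simp [mulVec, dotProduct, L, Fintype.linearCombination_apply]
      exact Finset.sum_congr rfl fun j _ => (Algebra.smul_def _ _).symm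
    refine ⟨fun r hr => ?_, fun r s hrs => ?_⟩
    · rw [hQ] at hr
      exact hr0.right_eq_zero_of_smul hr
    · rw [hQ, hQ] at hrs
      rw [hQ]
      change L c1 * r = L c0 * s at hrs
      change ∃ t, r = L c0 * t
      have := hr1.right_eq_zero_of_smul (x := Submodule.Quotient.mk r) (by
        rw [← Submodule.Quotient.mk_smul, Submodule.Quotient.mk_eq_zero, smul_eq_mul, hrs]
        exact Ideal.mul_mem_right _ _ (Ideal.mem_span_singleton_self _))
      rw [Submodule.Quotient.mk_eq_zero, Ideal.mem_span_singleton] at this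
      exact this

end Regularity

end SurfaceSing

/-! ### Consequences of the isolated singularity hypothesis -/

namespace SurfaceSing

open MvPolynomial Matrix

universe u

section Singularity

variable {F : Type u} [Field F] {f : MvPolynomial (Fin 3) F}

/-- `Ω³_R ≃ R/(∂f/∂x, ∂f/∂y, ∂f/∂z)`. -/
noncomputable def topFormsEquiv (f : MvPolynomial (Fin 3) F) :
    (HypersurfaceRing f ⧸ jacobianIdeal f) ≃ₗ[HypersurfaceRing f] KahlerForms f 3 :=
  exteriorThreeEquiv (toDifferentials_surjective f) (ker_toDifferentials f)

/-- Since `Ω³ ≃ R/J`, its support is the zero locus of the Jacobian ideal. -/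
theorem IsIsolatedHypersurfaceSingularity.eq_originIdeal
    (hf : IsIsolatedHypersurfaceSingularity f) {I : Ideal (HypersurfaceRing f)} (hI : I.IsPrime)
    (h : ∀ i, gradient f i ∈ I) : I = originIdeal f := by
  obtain ⟨x₀, hx₀, hsupp⟩ := hf
  have hmem : (⟨I, hI⟩ : PrimeSpectrum (HypersurfaceRing f)) ∈
      Module.support (HypersurfaceRing f) (KahlerForms f 3) := by
    rw [← (topFormsEquiv f).support_eq, Module.support_eq_zeroLocus, Ideal.annihilator_quotient,
      PrimeSpectrum.mem_zeroLocus, SetLike.coe_subset_coe, jacobianIdeal_eq, Ideal.span_le]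
    rintro _ ⟨i, rfl⟩
    exact h i
  rw [hsupp, Set.mem_singleton_iff] at hmem
  rw [← hx₀, ← hmem]

/-- For `f = 0` the gradient vanishes everywhere, in particular at `(1, 1, 1)`, which is not the
origin. -/
theorem IsIsolatedHypersurfaceSingularity.ne_zero
    (hf : IsIsolatedHypersurfaceSingularity f) : f ≠ 0 := by
  rintro rfl
  let φ : HypersurfaceRing (0 : MvPolynomial (Fin 3) F) →+* F :=
    Ideal.Quotient.lift (Ideal.span {0}) (MvPolynomial.eval (1 : Fin 3 → F)) (by simp)
  have h := hf.eq_originIdeal (RingHom.ker_isPrime φ) (fun i => by simp [gradient])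
  have hx : Ideal.Quotient.mk (Ideal.span {(0 : MvPolynomial (Fin 3) F)}) (X 0) ∈
      RingHom.ker φ := h ▸ Ideal.subset_span ⟨0, rfl⟩
  rw [RingHom.mem_ker, Ideal.Quotient.lift_mk] at hx
  simp at hx

end Singularity

end SurfaceSing

/-! ### The main theorem -/

theorem lemma3p1 {F : Type*} [Field F] [CharZero F] (f : MvPolynomial (Fin 3) F)
    (hf : SurfaceSing.IsIsolatedHypersurfaceSingularity f) :
    let R := SurfaceSing.HypersurfaceRing f
    let Ω1 := Ω[R⁄F]
    let Ω2 := SurfaceSing.KahlerForms f 2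
    let Ω3 := SurfaceSing.KahlerForms f 3
    let τ := SurfaceSing.tjurinaNumber f
    τ ≠ ⊤ ∧
    Nonempty (Ω3 ≃ₗ[R] SurfaceSing.ExtToRing f Ω1 1) ∧
    Nonempty (SurfaceSing.ExtToRing f Ω1 1 ≃ₗ[R] SurfaceSing.ExtToRing f Ω2 2) ∧
    Nonempty (Submodule.torsion R Ω2 ≃ₗ[R] SurfaceSing.ExtToRing f Ω2 1) ∧
    Module.length R Ω3 = τ ∧
    Module.length R (SurfaceSing.ExtToRing f Ω1 1) = τ ∧
    Module.length R (SurfaceSing.ExtToRing f Ω2 2) = τ ∧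
    Module.length R (Submodule.torsion R Ω2) = τ ∧
    Module.length R (SurfaceSing.ExtToRing f Ω2 1) = τ := by
  open SurfaceSing in
  intro R Ω1 Ω2 Ω3 τ
  -- Characteristic zero enters only here, to make prime avoidance by linear combinations possible.
  have : Infinite F := Infinite.of_injective _ (Nat.cast_injective (R := F))
  obtain ⟨P, hP, hb⟩ := exists_isRegularPair_mulVec hf.ne_zero (gradient f)
    fun I hI h => hf.eq_originIdeal hI h
  have hart := hb.isArtinianRing_quotient (ringKrullDim_hypersurfaceRing_add_one_le hf.ne_zero)
  have h0 : ∀ r : R, r • gradient f = 0 → r = 0 := fun r => eq_zero_of_smul_eq_zero hb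
  have h1 : ∀ v : Fin 3 → R, crossProduct (gradient f) v = 0 → ∃ r : R, r • gradient f = v :=
    fun v => exists_smul_of_cross_eq_zero hP hb
  have hp := toDifferentials_surjective f
  have ha := ker_toDifferentials f
  have hq := toExteriorTwo_surjective hp
  have hq' := ker_toExteriorTwo hp ha
  have hc : ∃ w : Fin 3 → R, dotProduct (gradient f) w ∈ nonZeroDivisors R := by
    -- Pairing with the first row of `P` gives the first member of the regular pair.
    refine ⟨P 0, mem_nonZeroDivisors_iff_right.mpr fun r hr => hb.fst r ?_⟩
    rw [mul_comm, ← hr, dotProduct_comm]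
    rfl
  have e3 : (R ⧸ jacobianIdeal f) ≃ₗ[R] Ω3 := topFormsEquiv f
  have e1 : (R ⧸ jacobianIdeal f) ≃ₗ[R] ExtToRing f Ω1 1 := extOneQuotientEquiv hp ha h0
  have e12 : ExtToRing f Ω1 1 ≃ₗ[R] ExtToRing f Ω2 2 := extOneEquivExtTwo hp ha h1 hq hq'
  have eH : KoszulH2 (gradient f) ≃ₗ[R] ExtToRing f Ω2 1 := extOneEquivKoszulH2 hp ha h1 hq hq'
  have eT : KoszulH2 (gradient f) ≃ₗ[R] Submodule.torsion R Ω2 := koszulH2EquivTorsion hq hq' hc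
  have hH : Module.length R (KoszulH2 (gradient f)) = τ := length_koszulH2 hP hb
  refine ⟨?_, ⟨e3.symm.trans e1⟩, ⟨e12⟩, ⟨eT.symm.trans eH⟩, e3.length_eq.symm, e1.length_eq.symm,
    (e1.trans e12).length_eq.symm, eT.length_eq.symm.trans hH, eH.length_eq.symm.trans hH⟩
  exact length_quotient_ne_top P (gradient f)
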